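/- Let $p$ be a prime and let $n$ be an integer with $p\le n\le 2p-1$; write $n=p+i$. Let the symmetric group $\mathfrak S_n$ permute the variables of $\mathbb F_p[x_1,\dots,x_n]$, let $e_1,\dots,e_n$ be the elementary symmetric polynomials in $x_1,\dots,x_n$, so that $\mathbb F_p[x_1,\dots,x_n]^{\mathfrak S_n}=\mathbb F_p[e_1,\dots,e_n]$, and let $$\operatorname{Tr}^{\mathfrak S_n}:\mathbb F_p[x_1,\dots,x_n]\to\mathbb F_p[e_1,\dots,e_n],\qquad \operatorname{Tr}^{\mathfrak S_n}(f)=\sum_{\sigma\in\mathfrak S_n}\sigma(f)$$ be the transfer map. Then the image of $\operatorname{Tr}^{\mathfrak S_n}$ is the ideal $$\tilde J_n=\langle e_1e_p-e_{p+1},\ e_2e_p-e_{p+2},\ \dots,\ e_ie_p-e_{p+i},\ e_{i+1},\ e_{i+2},\ \dots,\ e_{p-1}\rangle\subset\mathbb F_p[e_1,\dots,e_n].$$ This ideal is prime of height $p-1$. In particular, Neusel's upper bound $n-k$ for the height of the image of the transfer of a group with a cyclic Sylow $p$-subgroup that permutes the variables with $k$ orbits is attained: every Sylow $p$-subgroup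 $P$ of $\mathfrak S_n$ is cyclic, and the image of $\operatorname{Tr}^{\mathfrak S_n}$ has height exactly $n-k$, where $k$ is the number of orbits of $P$ on $\{x_1,\dots,x_n\}$. -/

import Mathlib

namespace SymTransfer

open MvPolynomial

/-- The ring of invariants `k[x_1, …, x_n]^{𝔖_n} = k[e_1, …, e_n]`, as a subalgebra of the
polynomial ring. -/
abbrev Inv (n : ℕ) (k : Type*) [CommRing k] : Subalgebra k (MvPolynomial (Fin n) k) :=
  symmetricSubalgebra (Fin n) k

/-- The elementary symmetric polynomial `e_j` in `n` variables, as an element of the ring of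
invariants. -/
noncomputable def e (n : ℕ) (k : Type*) [CommRing k] (j : ℕ) : Inv n k :=
  ⟨esymm (Fin n) k j, esymm_isSymmetric (Fin n) k j⟩

/-- A sum of all the images of a polynomial under permutations of the variables is symmetric. -/
theorem isSymmetric_sum_rename {n : ℕ} {k : Type*} [CommRing k] (f : MvPolynomial (Fin n) k) :
    (∑ g : Equiv.Perm (Fin n), rename g f).IsSymmetric := by
  intro h
  rw [map_sum]
  refine Fintype.sum_equiv (Equiv.mulLeft h) _ _ fun g => ?_
  rw [rename_rename]
  rfl

/-- The transfer map `Tr(f) = ∑_{g ∈ 𝔖_n} g(f)` from `k[x_1, …, x_n]` to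
`k[x_1, …, x_n]^{𝔖_n}`, where `𝔖_n` permutes the variables. It is linear over the ring of
invariants, so that its range is an ideal of this ring. -/
noncomputable def transfer (n : ℕ) (k : Type*) [CommRing k] :
    MvPolynomial (Fin n) k →ₗ[Inv n k] Inv n k where
  toFun f := ⟨∑ g : Equiv.Perm (Fin n), rename g f, isSymmetric_sum_rename f⟩
  map_add' f₁ f₂ := by
    apply Subtype.ext
    simp [Finset.sum_add_distrib]
  map_smul' r f := by
    apply Subtype.ext
    have hr : ∀ g : Equiv.Perm (Fin n), rename g (r : MvPolynomial (Fin n) k) = r := r.2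
    simp [Algebra.smul_def, hr, Finset.mul_sum]

/-- For `n = p + i`, the ideal
`⟨e_1 e_p - e_{p+1}, …, e_i e_p - e_{p+i}, e_{i+1}, …, e_{p-1}⟩` of `k[e_1, …, e_n]`
(the condition `j ≤ i` reads `p + j ≤ n`, and `i + 1 ≤ j` reads `n < p + j`). -/
noncomputable def J (p n : ℕ) (k : Type*) [CommRing k] : Ideal (Inv n k) :=
  Ideal.span
    ({f | ∃ j : ℕ, 1 ≤ j ∧ p + j ≤ n ∧ f = e n k j * e n k p - e n k (p + j)} ∪
      {f | ∃ j : ℕ, n < p + j ∧ j ≤ p - 1 ∧ f = e n k j})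

end SymTransfer

/-! Restrict invariants to the subspace where the first `p` variables agree. Transfers vanish there:
the permutations inducing a given colouring of the variables are a multiple of `p!` in number
(`diagRestrict_transfer`). So the image lies in the kernel of `invRestrict`, which is prime because
the target is a domain.

This kernel is `J` (`ker_invRestrict`): modulo `J` every invariant is a polynomial in `e_1, …, e_i,
e_p`, and these restrict to the algebraically independent elements `e_1(y), …, e_i(y), T^p`.

Conversely, the generators of `J` are transfers (`J_le_range_transfer`). Expand `e_j e_p` by the
size `l` of the overlap of the two index sets. The term `l = 0` is `e_{p+j}`, since the binomial
coefficient is `1` mod `p`; in the others every colour class has fewer than `p` points, so the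
stabilizer order is invertible.

The height is at most `p - 1` by Krull's theorem, and at least `p - 1` by a chain of kernels of
substitutions. A Sylow subgroup has order `p`, and Burnside's count gives `n - p + 1` orbits. -/

namespace SymTransfer

open MvPolynomial

/-! ### Colourings and their orbit sums -/

/-- Two colourings of a finite set with the same numbers of points of each colour differ by a
permutation. -/
theorem exists_perm_comp_eq {α ι : Type*} [Finite α] {f f' : α → ι}
    (h : ∀ i, Nat.card {a // f a = i} = Nat.card {a // f' a = i}) :
    ∃ g : Equiv.Perm α, f ∘ g = f' := by
  have hne : ∀ i, Nonempty ({a // f' a = i} ≃ {a // f a = i}) := fun i =>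
    (Finite.card_eq.1 (h i).symm)
  have E := fun i => (hne i).some
  refine ⟨(Equiv.sigmaFiberEquiv f').symm.trans
    ((Equiv.sigmaCongrRight E).trans (Equiv.sigmaFiberEquiv f)), ?_⟩
  funext a
  exact (E (f' a) ⟨a, rfl⟩).2

/-- The number of permutations taking one colouring to another one of the same type. -/
theorem card_perm_comp_eq {α ι : Type*} [Fintype α] [DecidableEq α] [Fintype ι] [DecidableEq ι]
    {f f' : α → ι} (h : ∀ i, Nat.card {a // f a = i} = Nat.card {a // f' a = i}) :
    (Finset.univ.filter fun g : Equiv.Perm α => f ∘ g = f').card =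
      ∏ i, (Nat.card {a // f a = i}).factorial := by
  obtain ⟨g₀, hg₀⟩ := exists_perm_comp_eq h
  have := DomMulAct.stabilizer_card f
  rw [Fintype.card_subtype] at this
  simp only [Nat.card_eq_fintype_card]
  rw [← this]
  refine Finset.card_bij' (fun g _ => g * g₀⁻¹) (fun g _ => g * g₀) ?_ ?_ ?_ ?_
  · intro g hg
    simp only [Finset.mem_filter, Finset.mem_univ, true_and] at hg ⊢
    rw [Equiv.Perm.coe_mul, ← Function.comp_assoc, hg, ← hg₀, Function.comp_assoc,
      ← Equiv.Perm.coe_mul]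
    simp
  · intro g hg
    simp only [Finset.mem_filter, Finset.mem_univ, true_and] at hg ⊢
    rw [Equiv.Perm.coe_mul, ← Function.comp_assoc, hg, hg₀]
  · intro g _
    simp
  · intro g _
    simp

/-- The monomial in which the exponent of a variable is the weight of its colour. -/
noncomputable def colourMonomial {n : ℕ} (k : Type*) [CommRing k] {ι : Type*} (w : ι → ℕ)
    (c : Fin n → ι) : MvPolynomial (Fin n) k :=
  ∏ m, X m ^ w (c m)

theorem rename_colourMonomial {n : ℕ} {k : Type*} [CommRing k] {ι : Type*} (w : ι → ℕ)
    (c : Fin n → ι) (g : Equiv.Perm (Fin n)) :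
    rename g (colourMonomial k w c) = colourMonomial k w (c ∘ g.symm) := by
  simp only [colourMonomial, map_prod, map_pow, rename_X]
  exact Fintype.prod_equiv g _ _ fun m => by simp

theorem coe_transfer {n : ℕ} {k : Type*} [CommRing k] (f : MvPolynomial (Fin n) k) :
    (transfer n k f : MvPolynomial (Fin n) k) = ∑ g : Equiv.Perm (Fin n), rename g f := rfl

/-- The sum of the monomials of all colourings of a given type is a transfer when the number of
points of each colour is less than the characteristic. -/
theorem exists_transfer_eq_sum_colourMonomial {p n : ℕ} (hp : p.Prime) (k : Type*) [Field k]
    [CharP k p] {ι : Type*} [Fintype ι] [DecidableEq ι] (w : ι → ℕ) (d : ι → ℕ)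
    (hd : ∀ i, d i < p) :
    ∃ f, (transfer n k f : MvPolynomial (Fin n) k) =
      ∑ c : Fin n → ι with ∀ i, Nat.card {a // c a = i} = d i, colourMonomial k w c := by
  classical
  set S := Finset.univ.filter fun c : Fin n → ι => ∀ i, Nat.card {a // c a = i} = d i with hS
  rcases S.eq_empty_or_nonempty with h | ⟨c₀, hc₀⟩
  · exact ⟨0, by simp [h]⟩
  have hc₀' : ∀ i, Nat.card {a // c₀ a = i} = d i := by simpa [hS] using hc₀
  set N : ℕ := ∏ i, (d i).factorial with hN
  have hN0 : (N : k) ≠ 0 := by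
    rw [Ne, CharP.cast_eq_zero_iff k p, hN, hp.prime.dvd_finsetProd_iff]
    rintro ⟨i, -, hi⟩
    exact absurd ((hp.dvd_factorial).1 hi) (not_le.2 (hd i))
  -- The orbit of `c₀` meets each colouring of its type exactly `N` times.
  refine ⟨C (N : k)⁻¹ * colourMonomial k w c₀, ?_⟩
  have key : ∑ g : Equiv.Perm (Fin n), colourMonomial k w (c₀ ∘ g.symm) =
      (N : MvPolynomial (Fin n) k) * ∑ c ∈ S, colourMonomial k w c := by
    rw [← Fintype.sum_equiv (Equiv.inv (Equiv.Perm (Fin n)))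
      (fun g => colourMonomial k w (c₀ ∘ g)) _ (fun g => by simp; rfl)]
    rw [← Finset.sum_fiberwise_of_maps_to (s := Finset.univ) (t := S)
      (g := fun g : Equiv.Perm (Fin n) => c₀ ∘ g), Finset.mul_sum]
    · refine Finset.sum_congr rfl fun c hc => ?_
      rw [Finset.sum_congr rfl (g := fun _ => colourMonomial k w c)
        (fun g hg => by rw [(Finset.mem_filter.1 hg).2])]
      rw [Finset.sum_const, card_perm_comp_eq, nsmul_eq_mul]
      · rw [hN, Finset.prod_congr rfl fun i _ => by rw [hc₀' i]]
      · intro i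
        rw [hc₀' i, ((Finset.mem_filter.1 hc).2 i)]
    · intro g _
      simp only [hS, Finset.mem_filter, Finset.mem_univ, true_and]
      intro i
      rw [← hc₀' i]
      exact Nat.card_congr (Equiv.subtypeEquiv g fun a => by simp)
  rw [coe_transfer]
  simp only [map_mul, rename_C, rename_colourMonomial]
  rw [← Finset.mul_sum, key, ← mul_assoc, ← map_natCast C, ← C_mul, inv_mul_cancel₀ hN0, C_1,
    one_mul]

/-! ### Generators of `J` as transfers -/

/-- The sum of the products `x^A x^B` over all pairs of sets of given sizes that meet in a set of
given size. -/
noncomputable def pairSum (n : ℕ) (k : Type*) [CommRing k] (a b l : ℕ) :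
    MvPolynomial (Fin n) k :=
  ∑ s : Finset (Fin n) × Finset (Fin n) with s.1.card = a ∧ s.2.card = b ∧ (s.1 ∩ s.2).card = l,
    (∏ m ∈ s.1, X m) * ∏ m ∈ s.2, X m

/-- A pair of subsets is a colouring by membership in each; the bounds say that all four classes
have fewer than `p` points. -/
theorem exists_transfer_eq_pairSum {p n : ℕ} (hp : p.Prime) (k : Type*) [Field k]
    [CharP k p] {a b l : ℕ} (hla : l ≤ a) (hlb : l ≤ b) (hab : a + b ≤ n) (hl : l < p)
    (ha : a - l < p) (hb : b - l < p) (hn : n + l - (a + b) < p) :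
    ∃ f, (transfer n k f : MvPolynomial (Fin n) k) = pairSum n k a b l := by
  classical
  let d : Bool × Bool → ℕ := fun x =>
    if x.1 then (if x.2 then l else a - l) else (if x.2 then b - l else n + l - (a + b))
  obtain ⟨f, hf⟩ := exists_transfer_eq_sum_colourMonomial (n := n) hp k
    (fun x : Bool × Bool => x.1.toNat + x.2.toNat) d (by
      rintro ⟨_ | _, _ | _⟩ <;> simpa [d])
  refine ⟨f, hf.trans ?_⟩
  have hcard : ∀ c : Fin n → Bool × Bool,
      (∀ x, Nat.card {m // c m = x} = d x) ↔
        (Finset.univ.filter fun m => (c m).1 = true).card = a ∧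
        (Finset.univ.filter fun m => (c m).2 = true).card = b ∧
        ((Finset.univ.filter fun m => (c m).1 = true) ∩
          Finset.univ.filter fun m => (c m).2 = true).card = l := by
    intro c
    have e1 : ∀ x, Nat.card {m // c m = x} = (Finset.univ.filter fun m => c m = x).card :=
      fun x => by rw [Nat.card_eq_fintype_card, Fintype.card_subtype]
    have e2 : (Finset.univ.filter fun m => (c m).1 = true).card =
        (Finset.univ.filter fun m => c m = (true, true)).card +
        (Finset.univ.filter fun m => c m = (true, false)).card := by
      rw [← Finset.card_union_of_disjoint]
      · congr 1; ext m; rcases h : c m with ⟨_ | _, _ | _⟩ <;> simp [h]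
      · rw [Finset.disjoint_filter]; intro m _ h; simp [h]
    have e3 : (Finset.univ.filter fun m => (c m).2 = true).card =
        (Finset.univ.filter fun m => c m = (true, true)).card +
        (Finset.univ.filter fun m => c m = (false, true)).card := by
      rw [← Finset.card_union_of_disjoint]
      · congr 1; ext m; rcases h : c m with ⟨_ | _, _ | _⟩ <;> simp [h]
      · rw [Finset.disjoint_filter]; intro m _ h; simp [h]
    have e4 : ((Finset.univ.filter fun m => (c m).1 = true) ∩
          Finset.univ.filter fun m => (c m).2 = true) =
        (Finset.univ.filter fun m => c m = (true, true)) := by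
      ext m; rcases h : c m with ⟨_ | _, _ | _⟩ <;> simp [h]
    have e5 : n = (Finset.univ.filter fun m => (c m).1 = true).card +
        ((Finset.univ.filter fun m => c m = (false, true)).card +
        (Finset.univ.filter fun m => c m = (false, false)).card) := by
      rw [← Finset.card_union_of_disjoint, ← Finset.card_union_of_disjoint]
      · conv_lhs => rw [← Fintype.card_fin n, ← Finset.card_univ]
        congr 1; ext m; rcases h : c m with ⟨_ | _, _ | _⟩ <;> simp [h]
      · rw [Finset.disjoint_left]; intro m h; simp at h; simp [Prod.ext_iff, h]
      · rw [Finset.disjoint_filter]; intro m _ h; simp [h]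
    rw [e4]
    simp only [e1, Prod.forall, Bool.forall_bool, d]
    simp
    omega
  rw [pairSum]
  refine Finset.sum_bij'
    (fun c _ => (Finset.univ.filter fun m => (c m).1 = true,
      Finset.univ.filter fun m => (c m).2 = true))
    (fun s _ m => (decide (m ∈ s.1), decide (m ∈ s.2))) ?_ ?_ ?_ ?_ ?_
  · intro c hc
    simp only [Finset.mem_filter, Finset.mem_univ, true_and] at hc ⊢
    exact (hcard c).1 hc
  · intro s hs
    simp only [Finset.mem_filter, Finset.mem_univ, true_and] at hs ⊢
    rw [hcard]
    simpa using hs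
  · intro c _
    funext m
    simp
  · intro s _
    simp
  · intro c _
    simp only [colourMonomial, pow_add, Finset.prod_mul_distrib, Finset.prod_filter]
    congr 1 <;> refine Finset.prod_congr rfl fun m _ => ?_
    · cases (c m).1 <;> simp
    · cases (c m).2 <;> simp

theorem esymm_mul_esymm_eq_sum_pairSum (n : ℕ) (k : Type*) [CommRing k] (a b : ℕ) :
    esymm (Fin n) k a * esymm (Fin n) k b = ∑ l ∈ Finset.range (a + 1), pairSum n k a b l := by
  rw [esymm, esymm, Finset.sum_mul_sum, ← Finset.sum_product',
    ← Finset.sum_fiberwise_of_maps_to (t := Finset.range (a + 1))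
      (g := fun s : Finset (Fin n) × Finset (Fin n) => (s.1 ∩ s.2).card)]
  · refine Finset.sum_congr rfl fun l _ => ?_
    rw [pairSum]
    refine Finset.sum_congr ?_ fun _ _ => rfl
    ext s
    simp [Finset.mem_powersetCard, and_assoc]
  · intro s hs
    simp only [Finset.mem_product, Finset.mem_powersetCard] at hs
    rw [Finset.mem_range, Nat.lt_succ_iff, ← hs.1.2]
    exact Finset.card_le_card Finset.inter_subset_left

/-- Group the disjoint pairs by their union `D`: each `D` splits in `(a + b).choose a` ways. -/
theorem pairSum_zero (n : ℕ) (k : Type*) [CommRing k] (a b : ℕ) :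
    pairSum n k a b 0 = ((a + b).choose a : MvPolynomial (Fin n) k) * esymm (Fin n) k (a + b) := by
  rw [pairSum, esymm, Finset.mul_sum,
    ← Finset.sum_fiberwise_of_maps_to (t := Finset.powersetCard (a + b) Finset.univ)
      (g := fun s : Finset (Fin n) × Finset (Fin n) => s.1 ∪ s.2)]
  · refine Finset.sum_congr rfl fun D hD => ?_
    rw [Finset.mem_powersetCard] at hD
    have : ((a + b).choose a : MvPolynomial (Fin n) k) * ∏ m ∈ D, X m =
        ∑ A ∈ D.powersetCard a, ∏ m ∈ D, X m := by
      rw [Finset.sum_const, Finset.card_powersetCard, hD.2, nsmul_eq_mul]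
    rw [this]
    refine Finset.sum_bij' (fun s _ => s.1) (fun A _ => (A, D \ A)) ?_ ?_ ?_ ?_ ?_
    · intro s hs
      simp only [Finset.mem_filter, Finset.mem_univ, true_and] at hs
      rw [Finset.mem_powersetCard, ← hs.2]
      exact ⟨Finset.subset_union_left, hs.1.1⟩
    · intro A hA
      rw [Finset.mem_powersetCard] at hA
      simp only [Finset.mem_filter, Finset.mem_univ, true_and]
      refine ⟨⟨hA.2, ?_, by simp⟩, Finset.union_sdiff_of_subset hA.1⟩
      rw [Finset.card_sdiff_of_subset hA.1, hD.2, hA.2]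
      omega
    · intro s hs
      simp only [Finset.mem_filter, Finset.mem_univ, true_and, Finset.card_eq_zero] at hs
      have hdisj : Disjoint s.2 s.1 := (Finset.disjoint_iff_inter_eq_empty.2 hs.1.2.2).symm
      refine Prod.ext rfl ?_
      simp only [← hs.2]
      rw [Finset.union_sdiff_left, Finset.sdiff_eq_self_of_disjoint hdisj]
    · intro A _
      rfl
    · intro s hs
      simp only [Finset.mem_filter, Finset.mem_univ, true_and, Finset.card_eq_zero] at hs
      rw [← hs.2, Finset.prod_union (Finset.disjoint_iff_inter_eq_empty.2 hs.1.2.2)]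
  · intro s hs
    simp only [Finset.mem_filter, Finset.mem_univ, true_and, Finset.card_eq_zero] at hs
    rw [Finset.mem_powersetCard,
      Finset.card_union_of_disjoint (Finset.disjoint_iff_inter_eq_empty.2 hs.2.2), hs.1, hs.2.1]
    exact ⟨Finset.subset_univ _, rfl⟩

theorem J_le_range_transfer {p n : ℕ} (hp : p.Prime) (hn : n ≤ 2 * p - 1) (k : Type*)
    [Field k] [CharP k p] : J p n k ≤ LinearMap.range (transfer n k) := by
  have := Fact.mk hp
  have hp1 := hp.one_lt
  rw [J]
  refine Ideal.span_le.2 (Set.union_subset ?_ ?_)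
  · rintro _ ⟨j, hj, hjn, rfl⟩
    -- The overlap `l + 1` is positive, which brings the class `B \ A` below `p` points.
    choose f hf using fun l : Fin j => exists_transfer_eq_pairSum (n := n) hp k
      (a := j) (b := p) (l := l + 1) (by omega) (by omega) (by omega) (by omega) (by omega)
      (by omega) (by omega)
    refine ⟨∑ l, f l, Subtype.ext ?_⟩
    -- Lucas' theorem, with `j < p`.
    have h1 : ((p + j).choose j : MvPolynomial (Fin n) k) = 1 := by
      have h := Choose.choose_modEq_choose_mod_mul_choose_div_nat (p := p) (n := p + j) (k := j)
      have hjp : j < p := by omega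
      rw [Nat.add_mod_left, Nat.mod_eq_of_lt hjp, Nat.div_eq_of_lt hjp, Nat.choose_self,
        Nat.choose_zero_right, mul_one] at h
      have := (CharP.natCast_eq_natCast (MvPolynomial (Fin n) k) p).2 h
      simpa using this
    have h2 : esymm (Fin n) k j * esymm (Fin n) k p - esymm (Fin n) k (p + j) =
        ∑ l : Fin j, pairSum n k j p (l + 1) := by
      rw [esymm_mul_esymm_eq_sum_pairSum, Finset.sum_range_succ', pairSum_zero, add_comm j p, h1,
        one_mul, add_sub_cancel_right, Finset.sum_range]
    simp only [map_sum, AddSubmonoidClass.coe_finsetSum, hf]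
    exact h2.symm
  · rintro _ ⟨j, hj, hjp, rfl⟩
    by_cases hjn : j ≤ n
    -- With an empty second set the pair sum is `e_j`; its classes have `j` and `n - j` points, both
    -- less than `p`.
    · obtain ⟨f, hf⟩ := exists_transfer_eq_pairSum (n := n) hp k
        (a := j) (b := 0) (l := 0) (by omega) (by omega) (by omega) (by omega) (by omega)
        (by omega) (by omega)
      refine ⟨f, Subtype.ext (hf.trans ?_)⟩
      rw [pairSum_zero]
      simp [e]
    · refine ⟨0, Subtype.ext ?_⟩
      have : esymm (Fin n) k j = 0 := by
        rw [esymm, Finset.powersetCard_eq_empty.2 (by simpa using hjn), Finset.sum_empty]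
      simp [e, this]

/-! ### Restriction to the subspace where `p` variables agree -/

/-- The colouring of `p + i` points in which the first `p` points have a common colour and all the
other points have colours of their own. -/
def diagColour (p i : ℕ) : Fin (p + i) → Option (Fin i) :=
  Fin.addCases (fun _ => none) some

/-- The coordinate ring of the linear subspace on which the first `p` of `p + i` variables agree:
the polynomial variable is their common value. -/
abbrev DiagRing (i : ℕ) (k : Type*) [CommRing k] : Type _ := Polynomial (MvPolynomial (Fin i) k)

/-- The value on the subspace of a variable of the given colour. -/
noncomputable def diagCoord (i : ℕ) (k : Type*) [CommRing k] : Option (Fin i) → DiagRing i k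
  | none => Polynomial.X
  | some j => Polynomial.C (X j)

/-- Restriction of polynomials to the subspace on which the first `p` variables agree. -/
noncomputable def diagRestrict (p i : ℕ) (k : Type*) [CommRing k] :
    MvPolynomial (Fin (p + i)) k →ₐ[k] DiagRing i k :=
  aeval fun m => diagCoord i k (diagColour p i m)

theorem diagRestrict_transfer {p i : ℕ} (k : Type*) [CommRing k] [CharP k p]
    (hp : 0 < p) (f : MvPolynomial (Fin (p + i)) k) :
    diagRestrict p i k (transfer (p + i) k f) = 0 := by
  classical
  rw [coe_transfer, map_sum]
  have h : ∀ g : Equiv.Perm (Fin (p + i)), diagRestrict p i k (rename g f) =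
      aeval (fun m => diagCoord i k ((diagColour p i ∘ g) m)) f := fun g => by
    rw [diagRestrict, aeval_rename]
    rfl
  simp only [h]
  rw [Finset.sum_comp (fun c => aeval (fun m => diagCoord i k (c m)) f)
    (fun g : Equiv.Perm (Fin (p + i)) => diagColour p i ∘ g)]
  refine Finset.sum_eq_zero fun c hc => ?_
  obtain ⟨g₀, -, rfl⟩ := Finset.mem_image.1 hc
  rw [card_perm_comp_eq, nsmul_eq_mul]
  · have hcard : Nat.card {a // diagColour p i a = none} = p := by
      refine (Nat.card_congr (Equiv.ofBijective
        (fun m : Fin p => ⟨Fin.castAdd i m, by simp [diagColour]⟩) ⟨?_, ?_⟩)).symm.trans (Nat.card_fin p)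
      · intro a b hab
        simpa using hab
      · rintro ⟨a, ha⟩
        induction a using Fin.addCases with
        | left m => exact ⟨m, rfl⟩
        | right m => simp [diagColour] at ha
    have hdvd : p ∣ ∏ x, (Nat.card {a // diagColour p i a = x}).factorial :=
      dvd_trans (by rw [hcard]; exact Nat.dvd_factorial hp le_rfl)
        (Finset.dvd_prod_of_mem _ (Finset.mem_univ none))
    rw [(CharP.cast_eq_zero_iff (DiagRing i k) p _).2 hdvd, zero_mul]
  · intro x
    exact (Nat.card_congr (Equiv.subtypeEquiv g₀ fun a => by simp)).symm

theorem coeff_prod_X_add_C_C_X (i : ℕ) (k : Type*) [CommRing k] (m : ℕ) :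
    (∏ j : Fin i, (Polynomial.X + Polynomial.C (Polynomial.C (X j))) :
      Polynomial (DiagRing i k)).coeff m =
      if m ≤ i then Polynomial.C (esymm (Fin i) k (i - m)) else 0 := by
  have h : (∏ j : Fin i, (Polynomial.X + Polynomial.C (Polynomial.C (X j))) :
      Polynomial (DiagRing i k)) = Polynomial.map Polynomial.C
        (∏ j : Fin i, (Polynomial.X + Polynomial.C (X j)) : Polynomial (MvPolynomial (Fin i) k)) := by
    simp [Polynomial.map_prod]
  rw [h, Polynomial.coeff_map]
  split_ifs with hm
  · rw [MvPolynomial.prod_X_add_C_coeff _ _ _ (by simpa using hm), Fintype.card_fin]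
  · rw [Polynomial.coeff_eq_zero_of_natDegree_lt, map_zero]
    refine lt_of_le_of_lt (Polynomial.natDegree_prod_le _ _) (lt_of_le_of_lt ?_ (not_le.1 hm))
    refine (Finset.sum_le_card_nsmul _ _ 1 fun j _ => (Polynomial.natDegree_add_C.trans_le
      Polynomial.natDegree_X_le)).trans ?_
    simp

/-- On the subspace the product of all `T + x_m` is `(T + X)^p = T^p + X^p` times the product of the
`T + y_j`; compare coefficients. -/
theorem diagRestrict_esymm {p i : ℕ} (k : Type*) [CommRing k] [CharP k p] (hp : p.Prime)
    {j : ℕ} (hj : j ≤ p + i) :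
    diagRestrict p i k (esymm (Fin (p + i)) k j) =
      (if j ≤ i then Polynomial.C (esymm (Fin i) k j) else 0) +
        Polynomial.X ^ p * if p ≤ j then Polynomial.C (esymm (Fin i) k (j - p)) else 0 := by
  have := Fact.mk hp
  have h1 : diagRestrict p i k (esymm (Fin (p + i)) k j) =
      (∏ m : Fin (p + i), (Polynomial.X + Polynomial.C (diagCoord i k (diagColour p i m)))).coeff
        (p + i - j) := by
    rw [Finset.prod_X_add_C_coeff _ _ (by simp), diagRestrict, esymm, map_sum]
    simp [map_prod, Nat.sub_sub_self hj]
  have h2 : (∏ m : Fin (p + i), (Polynomial.X + Polynomial.C (diagCoord i k (diagColour p i m)))) =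
      (Polynomial.X ^ p + Polynomial.C (Polynomial.X ^ p)) *
        ∏ j : Fin i, (Polynomial.X + Polynomial.C (Polynomial.C (X j)) :
          Polynomial (DiagRing i k)) := by
    rw [Fin.prod_univ_add]
    simp [diagColour, diagCoord, add_pow_char (R := Polynomial (DiagRing i k)) (p := p)]
  rw [h1, h2, add_mul, Polynomial.coeff_add, Polynomial.coeff_X_pow_mul', Polynomial.coeff_C_mul,
    coeff_prod_X_add_C_C_X, coeff_prod_X_add_C_C_X]
  congr 1
  · by_cases hji : j ≤ i
    · rw [if_pos (by omega), if_pos (by omega), if_pos hji]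
      congr 2
      omega
    · rw [if_neg (by omega), if_neg hji]
  · by_cases hpj : p ≤ j
    · rw [if_pos (by omega), if_pos hpj]
      congr 3
      omega
    · rw [if_neg (by omega), if_neg hpj]

/-- The restriction to the subspace on which the first `p` variables agree, as a ring homomorphism
on the ring of invariants. -/
noncomputable def invRestrict (p i : ℕ) (k : Type*) [CommRing k] :
    Inv (p + i) k →+* DiagRing i k :=
  (diagRestrict p i k : MvPolynomial (Fin (p + i)) k →+* DiagRing i k).comp
    (Inv (p + i) k).subtype

theorem invRestrict_e {p i : ℕ} (k : Type*) [CommRing k] [CharP k p] (hp : p.Prime)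
    {j : ℕ} (hj : j ≤ p + i) :
    invRestrict p i k (e (p + i) k j) =
      (if j ≤ i then Polynomial.C (esymm (Fin i) k j) else 0) +
        Polynomial.X ^ p * if p ≤ j then Polynomial.C (esymm (Fin i) k (j - p)) else 0 :=
  diagRestrict_esymm k hp hj

theorem J_le_ker_invRestrict {p i : ℕ} (k : Type*) [CommRing k] [CharP k p] (hp : p.Prime)
    (hi : i < p) : J p (p + i) k ≤ RingHom.ker (invRestrict p i k) := by
  rw [J]
  refine Ideal.span_le.2 (Set.union_subset ?_ ?_)
  · rintro _ ⟨j, hj, hjn, rfl⟩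
    have hji : j ≤ i := by omega
    rw [SetLike.mem_coe, RingHom.mem_ker, map_sub, map_mul, invRestrict_e k hp (by omega),
      invRestrict_e k hp (by omega), invRestrict_e k hp hjn, if_pos hji, if_neg (by omega),
      if_neg (by omega), if_pos le_rfl, if_neg (by omega), if_pos (by omega)]
    simp only [Nat.sub_self, Nat.add_sub_cancel_left, esymm_zero, map_one, mul_zero, add_zero,
      zero_add, mul_one]
    ring
  · rintro _ ⟨j, hj, hjp, rfl⟩
    have := hp.pos
    rw [SetLike.mem_coe, RingHom.mem_ker, invRestrict_e k hp (by omega), if_neg (by omega),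
      if_neg (by omega), mul_zero, add_zero]

/-! ### The kernel of the restriction is `J` -/

/-- The polynomials in `e_1, …, e_i` and `e_p`, as invariants. -/
noncomputable def freePart (p i : ℕ) (k : Type*) [CommRing k] :
    Polynomial (MvPolynomial (Fin i) k) →+* Inv (p + i) k :=
  Polynomial.eval₂RingHom
    (aeval fun j : Fin i => e (p + i) k (j + 1) : MvPolynomial (Fin i) k →ₐ[k] Inv (p + i) k)
    (e (p + i) k p)

theorem invRestrict_comp_freePart {p i : ℕ} (k : Type*) [CommRing k] [CharP k p] (hp : p.Prime)
    (hi : i < p) : (invRestrict p i k).comp (freePart p i k) =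
      (Polynomial.expand (MvPolynomial (Fin i) k) p : DiagRing i k →+* DiagRing i k).comp
        (Polynomial.mapRingHom ((symmetricSubalgebra (Fin i) k).subtype.comp
          (esymmAlgHom (Fin i) k i : MvPolynomial (Fin i) k →+* _))) := by
  refine Polynomial.ringHom_ext' (MvPolynomial.ringHom_ext ?_ ?_) ?_
  · intro a
    simp [freePart, invRestrict]
    rfl
  · intro j
    have := j.2
    have h := invRestrict_e (i := i) (j := j + 1) k hp (by omega)
    rw [if_pos (by omega), if_neg (by omega)] at h
    simp [freePart, h, esymmAlgHom]
    rfl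
  · have h := invRestrict_e (i := i) (j := p) k hp (by omega)
    rw [if_neg (by omega), if_pos le_rfl] at h
    simp [freePart, h]

theorem injective_invRestrict_comp_freePart {p i : ℕ} (k : Type*) [CommRing k] [CharP k p]
    (hp : p.Prime) (hi : i < p) :
    Function.Injective ((invRestrict p i k).comp (freePart p i k)) := by
  rw [invRestrict_comp_freePart k hp hi]
  refine (Polynomial.expand_injective hp.pos).comp (Polynomial.map_injective _ ?_)
  exact Subtype.val_injective.comp (esymmAlgHom_injective k (by simp))

theorem esymmAlgEquiv_X {n : ℕ} (k : Type*) [CommRing k] (m : Fin n) :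
    esymmAlgEquiv (Fin n) k (Fintype.card_fin n) (X m) = e n k (m + 1) := by
  rw [← esymmAlgEquiv_symm_apply k (Fintype.card_fin n), AlgEquiv.apply_symm_apply]
  rfl

/-- The generators of `J` eliminate every `e_m` except `e_1, …, e_i` and `e_p`. -/
theorem exists_sub_freePart_mem_J {p i : ℕ} (k : Type*) [CommRing k]
    (f : Inv (p + i) k) : ∃ q, f - freePart p i k q ∈ J p (p + i) k := by
  obtain ⟨f, rfl⟩ := (esymmAlgEquiv (Fin (p + i)) k (Fintype.card_fin _)).surjective f
  induction f using MvPolynomial.induction_on with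
  | C a =>
    refine ⟨Polynomial.C (C a), ?_⟩
    rw [← MvPolynomial.algebraMap_eq, AlgEquiv.commutes]
    simp [freePart]
  | add f g hf hg =>
    obtain ⟨q, hq⟩ := hf
    obtain ⟨r, hr⟩ := hg
    refine ⟨q + r, ?_⟩
    rw [map_add, map_add, add_sub_add_comm]
    exact add_mem hq hr
  | mul_X f m hf =>
    obtain ⟨q, hq⟩ := hf
    suffices h : ∃ r, e (p + i) k (m + 1) - freePart p i k r ∈ J p (p + i) k by
      obtain ⟨r, hr⟩ := h
      refine ⟨q * r, ?_⟩
      rw [map_mul, map_mul, esymmAlgEquiv_X]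
      have := add_mem (Ideal.mul_mem_right (e (p + i) k (m + 1)) _ hq)
        (Ideal.mul_mem_left _ (freePart p i k q) hr)
      convert this using 1
      ring
    have hX : ∀ j : Fin i, freePart p i k (Polynomial.C (X j)) = e (p + i) k (j + 1) := fun j => by
      simp [freePart]
    have hT : freePart p i k Polynomial.X = e (p + i) k p := by simp [freePart]
    have hm := m.2
    rcases lt_or_ge (m : ℕ) i with h1 | h1
    · exact ⟨Polynomial.C (X ⟨m, h1⟩), by simp [hX]⟩
    rcases lt_trichotomy ((m : ℕ) + 1) p with h2 | h2 | h2
    · exact ⟨0, by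
        rw [map_zero, sub_zero]
        exact Ideal.subset_span (Or.inr ⟨_, by omega, by omega, rfl⟩)⟩
    · exact ⟨Polynomial.X, by simp [hT, h2]⟩
    · obtain ⟨j, hj⟩ : ∃ j, (m : ℕ) + 1 = p + (j + 1) := ⟨m - p, by omega⟩
      refine ⟨Polynomial.C (X ⟨j, by omega⟩) * Polynomial.X, ?_⟩
      rw [map_mul, hX, hT, hj, ← neg_mem_iff, neg_sub]
      exact Ideal.subset_span (Or.inl ⟨j + 1, by omega, by omega, rfl⟩)

theorem ker_invRestrict {p i : ℕ} (k : Type*) [CommRing k] [CharP k p] (hp : p.Prime)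
    (hi : i < p) : RingHom.ker (invRestrict p i k) = J p (p + i) k := by
  refine le_antisymm (fun f hf => ?_) (J_le_ker_invRestrict k hp hi)
  obtain ⟨q, hq⟩ := exists_sub_freePart_mem_J k f
  have h := J_le_ker_invRestrict k hp hi hq
  rw [RingHom.mem_ker, map_sub, RingHom.mem_ker.1 hf, zero_sub, neg_eq_zero] at h
  have : q = 0 := injective_invRestrict_comp_freePart k hp hi (by simpa using h)
  simpa [this] using hq

theorem isPrime_J {p i : ℕ} (k : Type*) [Field k] [CharP k p] (hp : p.Prime) (hi : i < p) :
    (J p (p + i) k).IsPrime := by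
  rw [← ker_invRestrict k hp hi]
  exact RingHom.ker_isPrime _

theorem range_transfer {p i : ℕ} (k : Type*) [Field k] [CharP k p] (hp : p.Prime) (hi : i < p) :
    LinearMap.range (transfer (p + i) k) = J p (p + i) k := by
  refine le_antisymm ?_ (J_le_range_transfer hp (by omega) k)
  rintro _ ⟨f, rfl⟩
  rw [← ker_invRestrict k hp hi]
  exact diagRestrict_transfer k hp.pos f

/-! ### Sylow subgroups and their orbits -/

theorem card_sylow_perm {p n : ℕ} (hp : p.Prime) (hpn : p ≤ n) (hn : n < 2 * p)
    (P : Sylow p (Equiv.Perm (Fin n))) : Nat.card P = p := by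
  have := Fact.mk hp
  obtain ⟨i, rfl⟩ := Nat.exists_eq_add_of_le hpn
  rw [P.card_eq_multiplicity, Nat.card_perm, Nat.card_fin, Nat.factorization_def _ hp]
  have h := padicValNat_factorial_mul_add (p := p) (n := i) 1 (by omega)
  rw [padicValNat_factorial_mul, mul_one] at h
  simp [h]

/-- A `p`-subgroup of order `p` of a symmetric group on fewer than `2 p` points fixes all points
outside a single orbit with `p` elements. -/
theorem card_orbits_of_card_eq_prime {p n : ℕ} (hp : p.Prime) (hn : n < 2 * p)
    (P : Subgroup (Equiv.Perm (Fin n))) (hP : Nat.card P = p) :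
    Nat.card (MulAction.orbitRel.Quotient P (Fin n)) + p = n + 1 := by
  classical
  have := Fact.mk hp
  have hburn := MulAction.sum_card_fixedBy_eq_card_orbits_mul_card_group P (Fin n)
  rw [← Nat.card_eq_fintype_card, ← Nat.card_eq_fintype_card (α := P), hP] at hburn
  -- An element of order `p` on fewer than `2p` points is a single `p`-cycle.
  have hle : ∀ g : P, g ≠ 1 → Fintype.card (MulAction.fixedBy (Fin n) g) + p = n := by
    intro g hg
    have hord : orderOf (g : Equiv.Perm (Fin n)) = p := by
      rw [Subgroup.orderOf_coe]
      exact orderOf_eq_prime (hP ▸ pow_card_eq_one') hg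
    have hcyc : (g : Equiv.Perm (Fin n)).IsCycle :=
      Equiv.Perm.isCycle_of_prime_order' (by rwa [hord]) (by rwa [hord, Fintype.card_fin])
    have hsupp := hcyc.orderOf
    rw [hord] at hsupp
    have hfix : Fintype.card (MulAction.fixedBy (Fin n) g) =
        (g : Equiv.Perm (Fin n)).supportᶜ.card := by
      rw [← Set.toFinset_card]
      congr 1
      ext m
      simp [MulAction.mem_fixedBy, Subgroup.smul_def]
    rw [hfix, hsupp, add_comm, Finset.card_add_card_compl, Fintype.card_fin]
  have hsum : ∑ g : P, Fintype.card (MulAction.fixedBy (Fin n) g) =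
      n + (p - 1) * (n - p) := by
    rw [← Finset.add_sum_erase _ _ (Finset.mem_univ (1 : P))]
    congr 1
    · rw [← Nat.card_eq_fintype_card, MulAction.fixedBy_one_eq_univ]
      simp
    · rw [Finset.sum_congr rfl (g := fun _ => n - p) (fun g hg => by
        have := hle g (Finset.ne_of_mem_erase hg); omega), Finset.sum_const,
        Finset.card_erase_of_mem (Finset.mem_univ _), Finset.card_univ,
        ← Nat.card_eq_fintype_card, hP, smul_eq_mul]
  rw [hsum] at hburn
  have hpn : p ≤ n := by
    have : Nontrivial P := Finite.one_lt_card_iff_nontrivial.1 (hP ▸ hp.one_lt)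
    obtain ⟨g, hg⟩ := exists_ne (1 : P)
    have := hle g hg
    omega
  obtain ⟨i, rfl⟩ := Nat.exists_eq_add_of_le hpn
  obtain ⟨q, rfl⟩ := Nat.exists_eq_add_of_le hp.one_lt.le
  have h : Nat.card (MulAction.orbitRel.Quotient P (Fin (1 + q + i))) * (1 + q) =
      (i + 1) * (1 + q) := by
    rw [← hburn, Nat.add_sub_cancel_left, Nat.add_sub_cancel_left]
    ring
  have := Nat.eq_of_mul_eq_mul_right hp.pos h
  omega

/-! ### Heights of ideals that eliminate variables -/

section Substitution

variable {σ k : Type*} [CommRing k] [DecidableEq σ]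

/-- The substitution of `g m` for every variable `X m` with `m ∈ U`. -/
noncomputable def substOn (g : σ → MvPolynomial σ k) (U : Finset σ) :
    MvPolynomial σ k →ₐ[k] MvPolynomial σ k :=
  aeval fun m => if m ∈ U then g m else X m

-- `hg` encodes, through evaluations, that `g m` involves no variable from `S`.
variable {g : σ → MvPolynomial σ k} {S : Finset σ}
  (hg : ∀ m ∈ S, ∀ v w : σ → MvPolynomial σ k, (∀ x, x ∉ S → v x = w x) →
    aeval v (g m) = aeval w (g m))

include hg

theorem substOn_apply_self {V : Finset σ} (hV : V ⊆ S) {m : σ} (hm : m ∈ S) :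
    substOn g V (g m) = g m := by
  rw [substOn, hg m hm _ X fun x hx => if_neg fun h => hx (hV h)]
  simp

theorem substOn_comp_substOn {U V : Finset σ} (hUV : U ⊆ V) (hV : V ⊆ S) :
    (substOn g V).comp (substOn g U) = substOn g V := by
  refine MvPolynomial.algHom_ext fun m => ?_
  by_cases hm : m ∈ U
  · have : substOn g U (X m) = g m := by simp [substOn, hm]
    rw [AlgHom.comp_apply, this, substOn_apply_self hg hV (hV (hUV hm))]
    simp [substOn, hUV hm]
  · have : substOn g U (X m) = X m := by simp [substOn, hm]
    rw [AlgHom.comp_apply, this]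

theorem ker_substOn_lt_ker_substOn_insert [Nontrivial k] {U : Finset σ} {m : σ} (hm : m ∉ U)
    (hmU : insert m U ⊆ S) :
    RingHom.ker (substOn g U) < RingHom.ker (substOn g (insert m U)) := by
  have hmS : m ∈ S := hmU (Finset.mem_insert_self m U)
  have hU : U ⊆ S := (Finset.subset_insert m U).trans hmU
  refine lt_of_le_of_ne (fun f hf => ?_) fun h => ?_
  · rw [RingHom.mem_ker, ← substOn_comp_substOn hg (Finset.subset_insert m U) hmU,
      AlgHom.comp_apply, RingHom.mem_ker.1 hf, map_zero]
  · have h1 : X m - g m ∈ RingHom.ker (substOn g (insert m U)) := by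
      rw [RingHom.mem_ker, map_sub, substOn_apply_self hg hmU hmS]
      simp [substOn]
    rw [← h, RingHom.mem_ker, map_sub, substOn_apply_self hg hU hmS, sub_eq_zero] at h1
    have h2 : g m = X m := by
      rw [← h1]
      simp [substOn, hm]
    -- If `g m = X m`, then changing the value at `m` would change `g m`.
    have h3 := hg m hmS X (Function.update X m (X m + 1)) fun x hx => by
      rw [Function.update_of_ne]
      rintro rfl
      exact hx hmS
    simp [h2] at h3

/-- The kernels are prime and grow strictly with each variable added to `U`. -/
theorem card_le_height_ker_substOn [IsDomain k] {U : Finset σ} (hU : U ⊆ S) :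
    (U.card : ℕ∞) ≤ (RingHom.ker (substOn g U)).height := by
  induction U using Finset.induction_on with
  | empty => simp
  | insert m U hm ih =>
    rw [Finset.card_insert_of_notMem hm, Nat.cast_add, Nat.cast_one]
    refine (add_le_add_left (ih ((Finset.subset_insert m U).trans hU)) 1).trans ?_
    have := RingHom.ker_isPrime (substOn g U)
    have := RingHom.ker_isPrime (substOn g (insert m U))
    exact Ideal.height_add_one_le_of_lt_of_isPrime (ker_substOn_lt_ker_substOn_insert hg hm hU)

/-- An ideal containing `X m - g m` for all `m ∈ S`, where the polynomials `g m` involve only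
variables outside of `S`, has height at least the size of `S`. -/
theorem card_le_height_of_X_sub_mem [IsDomain k] {Q : Ideal (MvPolynomial σ k)}
    (hQ : ∀ m ∈ S, X m - g m ∈ Q) : (S.card : ℕ∞) ≤ Q.height := by
  refine (card_le_height_ker_substOn hg subset_rfl).trans (Ideal.height_mono fun f hf => ?_)
  have h : (Ideal.Quotient.mkₐ k Q).comp (substOn g S) = Ideal.Quotient.mkₐ k Q := by
    refine MvPolynomial.algHom_ext fun m => ?_
    by_cases hm : m ∈ S
    · have : substOn g S (X m) = g m := by simp [substOn, hm]
      rw [AlgHom.comp_apply, this, Ideal.Quotient.mkₐ_eq_mk, eq_comm, Ideal.Quotient.eq]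
      exact hQ m hm
    · have : substOn g S (X m) = X m := by simp [substOn, hm]
      rw [AlgHom.comp_apply, this]
  rw [← Ideal.Quotient.eq_zero_iff_mem, ← Ideal.Quotient.mkₐ_eq_mk k, ← h, AlgHom.comp_apply,
    RingHom.mem_ker.1 hf, map_zero]

end Substitution

/-! ### The height of `J` -/

theorem height_J_le {p i : ℕ} (k : Type*) [Field k] [CharP k p] (hp : p.Prime) (hi : i < p) :
    (J p (p + i) k).height ≤ ((p - 1 : ℕ) : ℕ∞) := by
  classical
  have : IsNoetherianRing (Inv (p + i) k) := isNoetherianRing_of_ringEquiv _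
    (esymmAlgEquiv (Fin (p + i)) k (Fintype.card_fin (p + i))).toRingEquiv
  let s : Finset (Inv (p + i) k) :=
    (Finset.Icc 1 i).image (fun j => e (p + i) k j * e (p + i) k p - e (p + i) k (p + j)) ∪
      (Finset.Icc (i + 1) (p - 1)).image fun j => e (p + i) k j
  have hs : J p (p + i) k = Ideal.span (s : Set (Inv (p + i) k)) := by
    rw [J]
    congr 1
    ext f
    simp only [Set.mem_union, Set.mem_ofPred_eq, s, Finset.coe_union, Finset.coe_image, Set.mem_image,
      Finset.coe_Icc, Set.mem_Icc]
    refine or_congr (exists_congr fun j => ?_) (exists_congr fun j => ?_)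
    · rw [add_le_add_iff_left, eq_comm, and_assoc]
    · rw [add_lt_add_iff_left, eq_comm, and_assoc, Nat.succ_le_iff]
  have hcard : s.card ≤ p - 1 := by
    refine (Finset.card_union_le _ _).trans ((add_le_add Finset.card_image_le
      Finset.card_image_le).trans ?_)
    rw [Nat.card_Icc, Nat.card_Icc]
    omega
  have hprime := isPrime_J k hp hi
  refine (Ideal.height_le_card_of_mem_minimalPrimes_span_finset (s := s) ?_).trans
    (Nat.cast_le.2 hcard)
  rw [← hs, Ideal.minimalPrimes_eq_subsingleton_self]
  rfl

theorem le_height_J {p i : ℕ} (k : Type*) [Field k] [CharP k p] (hi : i < p) :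
    ((p - 1 : ℕ) : ℕ∞) ≤ (J p (p + i) k).height := by
  let E := esymmAlgEquiv (Fin (p + i)) k (Fintype.card_fin (p + i))
  rw [← RingEquiv.height_comap E.toRingEquiv]
  -- `E` sends `X m` to `e_{m+1}`, so `last` stands for `e_p`, and `S` for `e_{i+1}, …, e_{p+i}`
  -- without `e_p`. The values of `g` solve the generators of `J` for these.
  let last : Fin (p + i) := ⟨p - 1, by omega⟩
  let g : Fin (p + i) → MvPolynomial (Fin (p + i)) k := fun m =>
    if (m : ℕ) < p then 0 else X ⟨m - p, by omega⟩ * X last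
  let S : Finset (Fin (p + i)) := (Finset.Ici ⟨i, by omega⟩).erase last
  have hS : ∀ m, m ∈ S ↔ (m : ℕ) ≠ p - 1 ∧ i ≤ m := fun m => by
    simp [S, last, Fin.ext_iff, Fin.le_def]
  have hcard : S.card = p - 1 := by
    rw [Finset.card_erase_of_mem (by simp [last, Fin.le_def]; omega), Fin.card_Ici]
    simp
  rw [← hcard]
  refine card_le_height_of_X_sub_mem (g := g) ?_ ?_
  · intro m hm v w hvw
    simp only [g]
    split_ifs with h
    · simp
    · simp only [map_mul, aeval_X]
      rw [hvw, hvw] <;> rw [hS]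
      · simp [last]
      · have := m.2
        dsimp only
        omega
  · intro m hm
    rw [hS] at hm
    have hX : ∀ x, E (X x) = e (p + i) k (x + 1) := esymmAlgEquiv_X k
    rw [Ideal.mem_comap]
    change E (X m - g m) ∈ _
    rw [map_sub, hX]
    simp only [g]
    split_ifs with h
    · rw [map_zero, sub_zero]
      exact Ideal.subset_span (Or.inr ⟨_, by omega, by omega, rfl⟩)
    · obtain ⟨j, hj⟩ : ∃ j, (m : ℕ) = p + j := ⟨m - p, by omega⟩
      have hlast : (last : ℕ) + 1 = p := by simp only [last]; omega
      rw [map_mul, hX, hX, hlast, ← neg_mem_iff, neg_sub]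
      have := m.2
      simp only [hj, Nat.add_sub_cancel_left, add_assoc]
      exact Ideal.subset_span (Or.inl ⟨j + 1, by omega, by omega, rfl⟩)

end SymTransfer

theorem corollary5p2 (p n : ℕ) (hp : p.Prime) (hpn : p ≤ n) (hn : n ≤ 2 * p - 1) :
    LinearMap.range (SymTransfer.transfer n (ZMod p)) = SymTransfer.J p n (ZMod p) ∧
    (SymTransfer.J p n (ZMod p)).IsPrime ∧
    (SymTransfer.J p n (ZMod p)).height = ((p - 1 : ℕ) : ℕ∞) ∧
    -- sharpness of the bound `ht ≤ n - #orbits` for cyclic Sylow `p`-subgroups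
    ∀ P : Sylow p (Equiv.Perm (Fin n)),
      IsCyclic P ∧
      Ideal.height (R := SymTransfer.Inv n (ZMod p))
          (LinearMap.range (SymTransfer.transfer n (ZMod p))) =
        ((n - Nat.card (MulAction.orbitRel.Quotient P (Fin n)) : ℕ) : ℕ∞) := by
  have := Fact.mk hp
  have hp0 := hp.pos
  obtain ⟨i, rfl⟩ := Nat.exists_eq_add_of_le hpn
  have hi : i < p := by omega
  have hheight := le_antisymm (SymTransfer.height_J_le (ZMod p) hp hi)
    (SymTransfer.le_height_J (ZMod p) hi)
  have hrange := SymTransfer.range_transfer (ZMod p) hp hi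
  refine ⟨hrange, SymTransfer.isPrime_J (ZMod p) hp hi, hheight, fun P => ?_⟩
  have hP := SymTransfer.card_sylow_perm hp hpn (by omega) P
  refine ⟨isCyclic_of_prime_card hP, ?_⟩
  have hk := SymTransfer.card_orbits_of_card_eq_prime (n := p + i) hp (by omega) P hP
  rw [hrange, hheight]
  congr 1
  have hk' : Nat.card (MulAction.orbitRel.Quotient P (Fin (p + i))) + p = p + i + 1 := hk
  omega
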